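/- Let $n,m\ge 1$ be integers. A permutation $\sigma$ of $[n]=\{1,\dots,n\}$ is viewed as a ranking in which $\sigma(x)$ is the rank of the element $x$. The Kendall $\tau$ distance is $d_\tau(\sigma,\pi)=|\{(x,y)\in[n]^2:\pi(x)>\pi(y),\ \sigma(x)<\sigma(y)\}|$, and for a permutation $\sigma_0$ of $[n]$ and $\phi\in(0,1]$ the Mallows model $\mathrm{MM}(\sigma_0,\phi)$ is the probability distribution on permutations of $[n]$ that gives $\sigma$ a probability proportional to $\phi^{d_\tau(\sigma_0,\sigma)}$. The Lehmer code of $\sigma$ is $c_\sigma(x)=|\{y:y<x,\ \sigma(y)>\sigma(x)\}|$, $x\in[n]$; it is a bijection from the permutations of $[n]$ onto $\{0\}\times\{0,1\}\times\dots\times\{0,\dots,n-1\}$. The Lehmer code aggregator with the mode rule takes permutations $\sigma_1,\dots,\sigma_m$, lets $\hat c(x)$ be a mode (a most frequent value) of $c_{\sigma_1}(x),\dots,c_{\sigma_m}(x)$ for each $x\in[n]$, and outputs the permutation $\hat\sigma$ whose Lehmer code is $\hat c$. Write $\phi_{s:t}=\sum_{k=s}^{t}\phi^k$ (an empty sum being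 $0$). **Theorem.** Let $\sigma_1,\dots,\sigma_m$ be i.i.d. samples from $\mathrm{MM}(\sigma_0,\phi)$, where $\phi\in(0,1]$, and let $\delta>0$. Put $$q=\frac{\phi_{1:n-1}}{1+\phi_{3:n}},\qquad c=\frac{2(1+q)^2}{(1-q)^4}.$$ If $\phi+\phi^2<1+\phi^n$ and $m\ge c\,\log\frac{n^2}{2\delta}$, then with probability at least $1-\delta$ the output $\hat\sigma$ of the Lehmer code aggregator with the mode rule on $\sigma_1,\dots,\sigma_m$ equals $\sigma_0$, however ties between modes are broken. -/

import Mathlib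

namespace LehmerAggregation

/-- A permutation of `n` elements. The elements are `Fin n` (that is, `0, …, n - 1` in place of
`1, …, n`), and `σ x` is the rank (position) of the element `x`. -/
abbrev Ranking (n : ℕ) : Type := Equiv.Perm (Fin n)

/-- Rankings form a finite set; every set of rankings is measurable. -/
instance rankingMeasurableSpace (n : ℕ) : MeasurableSpace (Equiv.Perm (Fin n)) := ⊤

/-- The Kendall `τ` distance: the number of pairs `(x, y)` with `π x > π y` and `σ x < σ y`. -/
def kendallTau {n : ℕ} (σ π : Ranking n) : ℕ :=
  (Finset.univ.filter fun p : Fin n × Fin n => π p.2 < π p.1 ∧ σ p.1 < σ p.2).card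

/-! ### The Mallows model -/

/-- The normalizing constant `∑ τ, φ ^ d(σ₀, τ)`. -/
noncomputable def mallowsZ {n : ℕ} (σ₀ : Ranking n) (φ : ℝ) : ℝ :=
  ∑ τ : Ranking n, φ ^ kendallTau σ₀ τ

theorem mallowsZ_pos {n : ℕ} (σ₀ : Ranking n) {φ : ℝ} (hφ : 0 < φ) : 0 < mallowsZ σ₀ φ :=
  Finset.sum_pos (fun _ _ => pow_pos hφ _) Finset.univ_nonempty

/-- The Mallows model `MM(σ₀, φ)`: the probability of `τ` is proportional to `φ ^ d(σ₀, τ)`. -/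
noncomputable def mallows {n : ℕ} (σ₀ : Ranking n) (φ : ℝ) (hφ : 0 < φ) : PMF (Ranking n) :=
  PMF.ofFintype (fun τ => ENNReal.ofReal (φ ^ kendallTau σ₀ τ / mallowsZ σ₀ φ)) (by
    have hZ := mallowsZ_pos σ₀ hφ
    rw [← ENNReal.ofReal_sum_of_nonneg (fun τ _ => div_nonneg (pow_nonneg hφ.le _) hZ.le),
      ← Finset.sum_div]
    change ENNReal.ofReal (mallowsZ σ₀ φ / mallowsZ σ₀ φ) = 1
    rw [div_self hZ.ne', ENNReal.ofReal_one])

/-! ### The Lehmer code -/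

/-- The codewords `{0} × [0,1] × ⋯ × [0,n-1]`. -/
abbrev LehmerWord (n : ℕ) : Type := (x : Fin n) → Fin (x.val + 1)

/-- The elements `y < x` with `σ y > σ x`. -/
def lehmerSet {n : ℕ} (σ : Ranking n) (x : Fin n) : Finset (Fin n) :=
  Finset.univ.filter fun y => y < x ∧ σ x < σ y

theorem lehmerSet_card_lt {n : ℕ} (σ : Ranking n) (x : Fin n) :
    (lehmerSet σ x).card < x.val + 1 := by
  have h : lehmerSet σ x ⊆ Finset.Iio x := fun y hy => by
    simp only [lehmerSet, Finset.mem_filter] at hy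
    exact Finset.mem_Iio.2 hy.2.1
  have h2 := Finset.card_le_card h
  rw [Fin.card_Iio] at h2
  omega

/-- The Lehmer code: `c_σ(x) = |{y : y < x, σ y > σ x}|`. -/
def lehmerCode {n : ℕ} (σ : Ranking n) : LehmerWord n :=
  fun x => ⟨(lehmerSet σ x).card, lehmerSet_card_lt σ x⟩

theorem lehmerCode_injective (n : ℕ) : Function.Injective (lehmerCode (n := n)) := by
  intro σ τ h
  have hcard : ∀ x, (lehmerSet σ x).card = (lehmerSet τ x).card := fun x =>
    congrArg Fin.val (congrFun h x)
  -- the relative orders of the elements up to `t` agree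
  have key : ∀ t : ℕ, ∀ x y : Fin n, x.val < t → y.val < t → (σ x < σ y ↔ τ x < τ y) := by
    intro t
    induction t with
    | zero => intro x y hx; omega
    | succ t ih =>
      have hset : ∀ x : Fin n, x.val = t → lehmerSet σ x = lehmerSet τ x := by
        intro x hx
        have hsub : lehmerSet σ x ⊆ lehmerSet τ x ∨ lehmerSet τ x ⊆ lehmerSet σ x := by
          by_contra hcon
          rw [not_or, Finset.not_subset, Finset.not_subset] at hcon
          obtain ⟨⟨a, ha, ha'⟩, b, hb, hb'⟩ := hcon
          simp only [lehmerSet, Finset.mem_filter, Finset.mem_univ, true_and, not_and,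
            not_lt] at ha ha' hb hb'
          have h1 := ha' ha.1
          have h2 := hb' hb.1
          have h3 : σ b < σ a := lt_of_le_of_lt h2 ha.2
          have h4 : τ a < τ b := lt_of_le_of_lt h1 hb.2
          have hax : a.val < t := hx ▸ ha.1
          have hbx : b.val < t := hx ▸ hb.1
          exact lt_asymm h4 ((ih b a hbx hax).1 h3)
        rcases hsub with hs | hs
        · exact Finset.eq_of_subset_of_card_le hs (hcard x).ge
        · exact (Finset.eq_of_subset_of_card_le hs (hcard x).le).symm
      have hlt : ∀ x y : Fin n, x.val = t → y.val < t → (σ x < σ y ↔ τ x < τ y) := by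
        intro x y hx hy
        have hyx : y < x := by rw [Fin.lt_def]; omega
        have hm := Finset.ext_iff.1 (hset x hx) y
        simpa [lehmerSet, hyx] using hm
      intro x y hx hy
      rcases Nat.lt_succ_iff_lt_or_eq.1 hx with hx | hx <;>
        rcases Nat.lt_succ_iff_lt_or_eq.1 hy with hy | hy
      · exact ih x y hx hy
      · have hne : x ≠ y := fun e => by subst e; omega
        have h1 := hlt y x hy hx
        have h2 : σ x ≠ σ y := fun e => hne (σ.injective e)
        have h3 : τ x ≠ τ y := fun e => hne (τ.injective e)
        rw [lt_iff_not_ge, lt_iff_not_ge, h2.symm.le_iff_lt, h3.symm.le_iff_lt, h1]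
      · exact hlt x y hx hy
      · have e : x = y := Fin.ext (hx.trans hy.symm)
        subst e
        simp
  have hord : ∀ a b : Fin n, (σ.symm.trans τ) a ≤ (σ.symm.trans τ) b ↔ a ≤ b := by
    intro a b
    have := key n (σ.symm b) (σ.symm a) (Fin.is_lt _) (Fin.is_lt _)
    simp only [Equiv.apply_symm_apply] at this
    rw [← not_lt, ← not_lt, this]
    rfl
  have hid : (⟨σ.symm.trans τ, fun {a b} => hord a b⟩ : Fin n ≃o Fin n) = OrderIso.refl _ :=
    Subsingleton.elim _ _
  ext x
  have hx := congrArg (fun e : Fin n ≃o Fin n => e (σ x)) hid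
  have hx' : τ (σ.symm (σ x)) = σ x := hx
  rw [Equiv.symm_apply_apply] at hx'
  rw [hx']

theorem lehmerCode_bijective (n : ℕ) : Function.Bijective (lehmerCode (n := n)) := by
  rw [Fintype.bijective_iff_injective_and_card]
  refine ⟨lehmerCode_injective n, ?_⟩
  rw [Fintype.card_perm, Fintype.card_fin, Fintype.card_pi]
  simp only [Fintype.card_fin]
  rw [Fin.prod_univ_eq_prod_range (fun i => i + 1) n, Finset.prod_range_add_one_eq_factorial]

/-- The inverse Lehmer code: the unique ranking with a given Lehmer code. -/
noncomputable def lehmerDecode {n : ℕ} (c : LehmerWord n) : Ranking n :=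
  (Equiv.ofBijective lehmerCode (lehmerCode_bijective n)).symm c

/-! ### The Lehmer code aggregator with the mode rule -/

/-- `v` is a mode of `s 0, …, s (m-1)`: no value occurs more often in the list than `v` does. -/
def IsMode {α : Type*} [DecidableEq α] {m : ℕ} (s : Fin m → α) (v : α) : Prop :=
  ∀ w : α, (Finset.univ.filter fun k => s k = w).card ≤ (Finset.univ.filter fun k => s k = v).card

/-- The possible outputs of the aggregator on the rankings `S 0, …, S (m-1)`: compute the Lehmer
codes, take in each coordinate a mode `c x` of the values of that coordinate, and apply the
inverse Lehmer code to `c`. There is one output for each way to break ties between modes. -/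
def modeOutputs {n m : ℕ} (S : Fin m → Ranking n) : Set (Ranking n) :=
  {τ | ∃ c : LehmerWord n, (∀ x, IsMode (fun k => lehmerCode (S k) x) (c x)) ∧
    τ = lehmerDecode c}

/-! ### The constants -/

/-- `φ_{s:t} = ∑_{k=s}^{t} φ ^ k`, an empty sum being `0`. -/
noncomputable def powSum (φ : ℝ) (s t : ℕ) : ℝ := ∑ k ∈ Finset.Icc s t, φ ^ k

/-- `q = φ_{1:n-1} / (1 + φ_{3:n})`. -/
noncomputable def qConst (φ : ℝ) (n : ℕ) : ℝ := powSum φ 1 (n - 1) / (1 + powSum φ 3 n)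

/-- `c = 2 (1 + q)² / (1 - q)⁴`. -/
noncomputable def cConst (φ : ℝ) (n : ℕ) : ℝ :=
  2 * (1 + qConst φ n) ^ 2 / (1 - qConst φ n) ^ 4

end LehmerAggregation

/-! Renaming each element by its rank under σ₀ turns the Mallows weight into φ^inv(π) for π = τ ∘
σ₀⁻¹. With V the renamed set of elements below x, the Lehmer code of τ at x is |V| minus the number
of elements of V that π ranks before σ₀ x. The core claim is that this number has a unimodal law:
its mode is the value given by σ₀, and on each side every step away from the mode costs a factor at
most q.

To prove it, π is built by choosing its elements in order, each time one of relative rank r among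
those left with weight φ^r. Conditioning on the first choice compares the probabilities of j and j +
1 by induction (`precedeProb_le_mul_succ`). The only term without a counterpart is, for j = 0, the
choice of x itself. It is paid for by the sequences that start with an element of V and then put x
before the rest of V (`pow_relRank_le_ratioBound_mul`), and this is where q comes from. Reversing
elements and ranks preserves inversions and gives the other side of the mode.

Summing the geometric decay bounds the mode's probability below by (1 - q)/(1 + q), so it exceeds
that of any other value by at least D = (1 - q)²/(1 + q). Since c = 2/D², Hoeffding's inequality
shows that a given wrong value ties with or beats the true one with probability at most 2δ/n². There
are n(n - 1)/2 wrong values over all coordinates, and a union bound finishes. The condition on φ is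
what makes q < 1; its weak form φ²(1 + ⋯ + φ^(n-3)) ≤ 1 also enters the core estimate. -/

namespace LehmerAggregation

/-! ### Geometric sums -/

/-- `1 + φ + ⋯ + φ ^ (k - 1)`. -/
noncomputable def geomSum (φ : ℝ) (k : ℕ) : ℝ := ∑ i ∈ Finset.range k, φ ^ i

theorem geomSum_succ (φ : ℝ) (k : ℕ) : geomSum φ (k + 1) = geomSum φ k + φ ^ k := by
  simp [geomSum, Finset.sum_range_succ]

theorem geomSum_succ_left (φ : ℝ) (k : ℕ) : geomSum φ (k + 1) = 1 + φ * geomSum φ k := by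
  simp [geomSum, Finset.sum_range_succ', Finset.mul_sum, pow_succ', add_comm]

theorem geomSum_nonneg {φ : ℝ} (hφ : 0 < φ) (k : ℕ) : 0 ≤ geomSum φ k :=
  Finset.sum_nonneg fun _ _ => (pow_pos hφ _).le

theorem geomSum_succ_pos {φ : ℝ} (hφ : 0 < φ) (k : ℕ) : 0 < geomSum φ (k + 1) := by
  rw [geomSum_succ]
  have := geomSum_nonneg hφ k
  positivity

theorem geomSum_mono {φ : ℝ} (hφ : 0 < φ) : Monotone (geomSum φ) :=
  monotone_nat_of_le_succ fun k => by
    rw [geomSum_succ]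
    have := pow_pos hφ k
    linarith

theorem one_sub_mul_geomSum (φ : ℝ) (k : ℕ) : (1 - φ) * geomSum φ k = 1 - φ ^ k := by
  rw [geomSum, mul_comm, geom_sum_mul_neg]

/-- The ratio `φ [k + 1] / (1 + φ ^ 3 [k])`, where `[k] = 1 + φ + ⋯ + φ ^ (k - 1)`. -/
noncomputable def ratioBound (φ : ℝ) (k : ℕ) : ℝ :=
  φ * geomSum φ (k + 1) / (1 + φ ^ 3 * geomSum φ k)

theorem ratioBound_den_pos {φ : ℝ} (hφ : 0 < φ) (k : ℕ) : 0 < 1 + φ ^ 3 * geomSum φ k := by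
  have := geomSum_nonneg hφ k
  positivity

theorem ratioBound_pos {φ : ℝ} (hφ : 0 < φ) (k : ℕ) : 0 < ratioBound φ k :=
  div_pos (mul_pos hφ (geomSum_succ_pos hφ k)) (ratioBound_den_pos hφ k)

/-- After cross-multiplication the difference is φ φ^(k+1) (1 - φ²). This lets estimates for the
shrinking sets of the induction be replaced by the one for the full set. -/
theorem ratioBound_mono {φ : ℝ} (hφ : 0 < φ) (hφ1 : φ ≤ 1) : Monotone (ratioBound φ) :=
  monotone_nat_of_le_succ fun k => by
    rw [ratioBound, ratioBound, div_le_div_iff₀ (ratioBound_den_pos hφ k)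
      (ratioBound_den_pos hφ (k + 1)), geomSum_succ φ (k + 1), geomSum_succ φ k]
    have h1 : geomSum φ k + φ ^ k = 1 + φ * geomSum φ k := by
      rw [← geomSum_succ, geomSum_succ_left]
    have h2 : 0 ≤ φ * φ ^ (k + 1) * (1 - φ ^ 2) := by
      have : φ ^ 2 ≤ 1 := pow_le_one₀ hφ.le hφ1
      have := pow_pos hφ (k + 1)
      apply mul_nonneg (by positivity); linarith
    have h3 : φ ^ 2 * (geomSum φ k + φ ^ k) = φ ^ 2 + φ ^ 3 * geomSum φ k := by
      rw [h1]; ring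
    have h4 : φ * (geomSum φ k + φ ^ k + φ ^ (k + 1)) * (1 + φ ^ 3 * geomSum φ k) -
        φ * (geomSum φ k + φ ^ k) * (1 + φ ^ 3 * (geomSum φ k + φ ^ k)) =
        φ * φ ^ (k + 1) * (1 + φ ^ 3 * geomSum φ k - φ ^ 2 * (geomSum φ k + φ ^ k)) := by
      ring
    rw [h3] at h4
    linarith

theorem sq_mul_geomSum_le_one {φ : ℝ} (hφ1 : φ < 1) {k : ℕ}
    (h : φ + φ ^ 2 ≤ 1 + φ ^ (k + 2)) : φ ^ 2 * geomSum φ k ≤ 1 := by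
  have h1 := one_sub_mul_geomSum φ k
  have h2 : (1 - φ) * (φ ^ 2 * geomSum φ k) ≤ (1 - φ) * 1 := by
    calc (1 - φ) * (φ ^ 2 * geomSum φ k) = φ ^ 2 * ((1 - φ) * geomSum φ k) := by ring
      _ = φ ^ 2 - φ ^ (k + 2) := by rw [h1]; ring
      _ ≤ (1 - φ) * 1 := by linarith
  exact le_of_mul_le_mul_left h2 (by linarith)

/-! ### Relative ranks in a finite set -/

section RelRank

variable {α : Type*} [LinearOrder α]

/-- The number of elements of `R` below `e`. -/
def relRank (R : Finset α) (e : α) : ℕ := (R.filter (· < e)).card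

theorem relRank_mono {R T : Finset α} (h : T ⊆ R) (e : α) : relRank T e ≤ relRank R e :=
  Finset.card_le_card (Finset.filter_subset_filter _ h)

theorem relRank_erase_of_lt {R : Finset α} {w e : α} (hw : w ∈ R) (h : w < e) :
    relRank R e = relRank (R.erase w) e + 1 := by
  rw [relRank, relRank, Finset.filter_erase, Finset.card_erase_add_one]
  simp [hw, h]

theorem relRank_erase_of_not_lt {R : Finset α} {w e : α} (h : ¬ w < e) :
    relRank (R.erase w) e = relRank R e := by
  rw [relRank, relRank, Finset.filter_erase, Finset.erase_eq_of_notMem]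
  simp [h]

theorem sum_pow_relRank (φ : ℝ) (R : Finset α) :
    ∑ e ∈ R, φ ^ relRank R e = geomSum φ R.card := by
  induction R using Finset.induction_on_max with
  | empty => simp [geomSum]
  | insert a s ha ih =>
    have has : a ∉ s := fun h => lt_irrefl _ (ha a h)
    rw [Finset.sum_insert has, Finset.card_insert_of_notMem has, geomSum_succ, ← ih, add_comm]
    have hs : ∀ e, ¬ a < e → relRank (insert a s) e = relRank s e := by
      intro e he
      rw [← relRank_erase_of_not_lt he, Finset.erase_insert has]
    congr 1
    · refine Finset.sum_congr rfl fun e he => ?_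
      rw [hs e (ha e he).not_gt]
    · rw [hs a (lt_irrefl a), relRank, Finset.filter_true_of_mem ha]

/-- Ranks within a subset are at most those in the whole set, and φ ≤ 1. -/
theorem sum_pow_relRank_le {φ : ℝ} (hφ : 0 < φ) (hφ1 : φ ≤ 1) {R T : Finset α} (h : T ⊆ R) :
    ∑ e ∈ T, φ ^ relRank R e ≤ geomSum φ T.card := by
  rw [← sum_pow_relRank]
  exact Finset.sum_le_sum fun e _ => pow_le_pow_of_le_one hφ.le hφ1 (relRank_mono h e)

/-- Choosing e then x, instead of x then e, is an adjacent transposition, which changes the total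
exponent by one. -/
theorem relRank_add_relRank_erase_le {R : Finset α} {x e : α} (hx : x ∈ R) (he : e ∈ R)
    (hne : e ≠ x) :
    relRank R e + relRank (R.erase e) x ≤ relRank (R.erase x) e + 1 + relRank R x := by
  rcases lt_or_gt_of_ne hne with h | h
  · rw [relRank_erase_of_not_lt (R := R) (w := x) (e := e) h.not_gt, relRank_erase_of_lt he h]
    omega
  · rw [relRank_erase_of_not_lt (R := R) (w := e) (e := x) h.not_gt, relRank_erase_of_lt hx h]

/-! ### Sequential choice of the elements of a ranking -/

/-- The elements of a set `R` with `N` elements are chosen one after another, each time an element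
of rank `r` among the remaining ones with a probability proportional to `φ ^ r`. This is the
probability that exactly `j` elements of `V` are chosen before `x`. -/
noncomputable def precedeProb (φ : ℝ) (V : Finset α) (x : α) : ℕ → Finset α → ℕ → ℝ
  | 0, _, _ => 0
  | N + 1, R, j =>
    ((if j = 0 then φ ^ relRank R x else 0) +
      ∑ e ∈ R.erase x, φ ^ relRank R e *
        (if e ∈ V then (if j = 0 then 0 else precedeProb φ V x N (R.erase e) (j - 1))
          else precedeProb φ V x N (R.erase e) j)) / geomSum φ (N + 1)

variable {φ : ℝ} {V : Finset α} {x : α}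

theorem precedeProb_nonneg (hφ : 0 < φ) (N : ℕ) (R : Finset α) (j : ℕ) :
    0 ≤ precedeProb φ V x N R j := by
  induction N generalizing R j with
  | zero => simp [precedeProb]
  | succ N ih =>
    rw [precedeProb]
    refine div_nonneg (add_nonneg ?_ (Finset.sum_nonneg fun e _ => ?_)) (geomSum_nonneg hφ _)
    · split_ifs <;> positivity
    · refine mul_nonneg (by positivity) ?_
      split_ifs
      · exact le_rfl
      · exact ih _ _
      · exact ih _ _

theorem geomSum_mul_precedeProb_zero (hφ : 0 < φ) (N : ℕ) (R : Finset α) :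
    geomSum φ (N + 1) * precedeProb φ V x (N + 1) R 0 = φ ^ relRank R x +
      ∑ w ∈ (R.erase x) \ V, φ ^ relRank R w * precedeProb φ V x N (R.erase w) 0 := by
  rw [precedeProb, mul_div_cancel₀ _ (geomSum_succ_pos hφ N).ne', if_pos rfl,
    Finset.sdiff_eq_filter, Finset.sum_filter]
  congr 1
  refine Finset.sum_congr rfl fun e _ => ?_
  by_cases h : e ∈ V <;> simp [h]

theorem geomSum_mul_precedeProb_succ (hφ : 0 < φ) (hxV : x ∉ V) (N : ℕ) (R : Finset α) (j : ℕ) :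
    geomSum φ (N + 1) * precedeProb φ V x (N + 1) R (j + 1) =
      ∑ w ∈ (R.erase x) \ V, φ ^ relRank R w * precedeProb φ V x N (R.erase w) (j + 1) +
      ∑ v ∈ R ∩ V, φ ^ relRank R v * precedeProb φ V x N (R.erase v) j := by
  have hRV : R ∩ V = (R.erase x).filter (· ∈ V) := by
    ext e
    simp only [Finset.mem_inter, Finset.mem_filter, Finset.mem_erase]
    constructor
    · rintro ⟨h1, h2⟩
      exact ⟨⟨fun h => hxV (h ▸ h2), h1⟩, h2⟩
    · rintro ⟨⟨_, h1⟩, h2⟩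
      exact ⟨h1, h2⟩
  rw [precedeProb, mul_div_cancel₀ _ (geomSum_succ_pos hφ N).ne', if_neg (by omega), zero_add,
    Finset.sdiff_eq_filter, hRV, Finset.sum_filter, Finset.sum_filter, ← Finset.sum_add_distrib]
  refine Finset.sum_congr rfl fun e _ => ?_
  by_cases h : e ∈ V <;> simp [h]

/-- The probability that `x` comes before all elements of `V`. -/
theorem le_precedeProb_zero (hφ : 0 < φ) (hφ1 : φ ≤ 1) (hxV : x ∉ V) (N : ℕ) (R : Finset α)
    (hR : R.card = N) (hx : x ∈ R) :
    φ ^ relRank R x ≤ geomSum φ ((R ∩ V).card + 1) * precedeProb φ V x N R 0 := by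
  induction N generalizing R with
  | zero => rw [Finset.card_eq_zero] at hR; simp [hR] at hx
  | succ N ih =>
    set k := (R ∩ V).card + 1 with hk
    have hkpos : 0 < geomSum φ k := geomSum_succ_pos hφ _
    have hNpos := geomSum_succ_pos hφ N
    -- The total weight of R is split into x with R ∩ V, which has k elements and hence weight at
    -- most [k], and the neutral elements, whose choice leaves R ∩ V intact.
    have hsum : geomSum φ (N + 1) ≤ geomSum φ k + ∑ w ∈ (R.erase x) \ V, φ ^ relRank R w := by
      have hdis : Disjoint (insert x (R ∩ V)) ((R.erase x) \ V) := by
        rw [Finset.disjoint_left]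
        intro e he he'
        simp only [Finset.mem_insert, Finset.mem_inter, Finset.mem_sdiff, Finset.mem_erase] at he he'
        tauto
      have hun : R = insert x (R ∩ V) ∪ ((R.erase x) \ V) := by
        ext e
        simp only [Finset.mem_insert, Finset.mem_inter, Finset.mem_sdiff, Finset.mem_erase,
          Finset.mem_union]
        by_cases h : e = x
        · subst h; tauto
        · tauto
      have hxn : x ∉ R ∩ V := fun h => hxV (Finset.mem_inter.1 h).2
      have h1 := sum_pow_relRank φ R
      rw [hR] at h1
      rw [← h1]
      nth_rewrite 1 [hun]
      rw [Finset.sum_union hdis]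
      have h2 := sum_pow_relRank_le hφ hφ1 (R := R) (T := insert x (R ∩ V))
        (Finset.insert_subset hx Finset.inter_subset_left)
      rw [Finset.card_insert_of_notMem hxn] at h2
      linarith
    have hterm : ∑ w ∈ (R.erase x) \ V, φ ^ relRank R w * φ ^ relRank R x ≤
        geomSum φ k * ∑ w ∈ (R.erase x) \ V,
          φ ^ relRank R w * precedeProb φ V x N (R.erase w) 0 := by
      rw [Finset.mul_sum]
      refine Finset.sum_le_sum fun w hw => ?_
      simp only [Finset.mem_sdiff, Finset.mem_erase] at hw
      have h1 := ih (R.erase w) (by rw [Finset.card_erase_of_mem hw.1.2, hR]; rfl)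
        (Finset.mem_erase.2 ⟨hw.1.1.symm, hx⟩)
      have h2 : R.erase w ∩ V = R ∩ V := by
        ext e
        simp only [Finset.mem_inter, Finset.mem_erase]
        constructor
        · tauto
        · rintro ⟨h1, h2⟩
          exact ⟨⟨fun h => hw.2 (h ▸ h2), h1⟩, h2⟩
      rw [h2] at h1
      have h3 : φ ^ relRank R x ≤ φ ^ relRank (R.erase w) x :=
        pow_le_pow_of_le_one hφ.le hφ1 (relRank_mono (Finset.erase_subset _ _) _)
      have h4 := mul_le_mul_of_nonneg_left (h3.trans h1) (pow_pos hφ (relRank R w)).le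
      linarith
    refine le_of_mul_le_mul_left ?_ hNpos
    have h5 := geomSum_mul_precedeProb_zero (V := V) (x := x) hφ N R
    calc geomSum φ (N + 1) * φ ^ relRank R x
        ≤ (geomSum φ k + ∑ w ∈ (R.erase x) \ V, φ ^ relRank R w) * φ ^ relRank R x :=
          mul_le_mul_of_nonneg_right hsum (by positivity)
      _ = geomSum φ k * φ ^ relRank R x +
          ∑ w ∈ (R.erase x) \ V, φ ^ relRank R w * φ ^ relRank R x := by
          rw [add_mul, Finset.sum_mul]
      _ ≤ geomSum φ k * (geomSum φ (N + 1) * precedeProb φ V x (N + 1) R 0) := by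
          rw [h5, mul_add]
          linarith
      _ = _ := by ring

/-- A smallest element outside `V` does not matter. -/
theorem precedeProb_erase_min (hφ : 0 < φ) {w : α} (hwV : w ∉ V) (N : ℕ)
    (R : Finset α) (j : ℕ) (hR : R.card = N + 1) (hx : x ∈ R) (hw : w ∈ R) (hwx : w ≠ x)
    (hmin : ∀ y ∈ R, w ≤ y) :
    precedeProb φ V x (N + 1) R j = precedeProb φ V x N (R.erase w) j := by
  induction N generalizing R j with
  | zero =>
    exact absurd (Finset.card_le_one.1 (by omega) w hw x hx) hwx
  | succ N ih =>
    have hlt : ∀ y ∈ R.erase w, w < y := fun y hy =>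
      lt_of_le_of_ne (hmin y (Finset.mem_of_mem_erase hy)) (Finset.ne_of_mem_erase hy).symm
    have hrk : ∀ y ∈ R.erase w, relRank R y = relRank (R.erase w) y + 1 := fun y hy =>
      relRank_erase_of_lt hw (hlt y hy)
    have hrkw : relRank R w = 0 := by
      rw [relRank, Finset.card_eq_zero, Finset.filter_eq_empty_iff]
      exact fun y hy => (hmin y hy).not_gt
    have hxw : x ∈ R.erase w := Finset.mem_erase.2 ⟨hwx.symm, hx⟩
    set F := precedeProb φ V x (N + 1) (R.erase w) j with hF
    have hNpos := geomSum_succ_pos hφ N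
    have hFeq : geomSum φ (N + 1) * F = (if j = 0 then φ ^ relRank (R.erase w) x else 0) +
      ∑ e ∈ (R.erase w).erase x, φ ^ relRank (R.erase w) e *
        (if e ∈ V then (if j = 0 then 0 else precedeProb φ V x N ((R.erase w).erase e) (j - 1))
          else precedeProb φ V x N ((R.erase w).erase e) j) := by
      rw [hF, precedeProb, mul_div_cancel₀ _ hNpos.ne']
    -- Choosing w has weight 1 and leaves F; every other rank is one more than in R \ {w}, so the
    -- remaining terms add up to φ [N+1] F by induction. Together they give [N+2] F = (1 + φ [N+1])
    -- F.
    rw [precedeProb, div_eq_iff (geomSum_succ_pos hφ (N + 1)).ne', geomSum_succ_left, mul_add,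
      mul_one, mul_left_comm, mul_comm F, hFeq,
      ← Finset.add_sum_erase (R.erase x) _ (Finset.mem_erase.2 ⟨hwx, hw⟩), if_neg hwV, hrkw,
      pow_zero, one_mul, ← hF, Finset.erase_right_comm, mul_add, Finset.mul_sum, add_left_comm]
    congr 2
    · rw [hrk x hxw]
      split_ifs
      · rw [pow_succ']
      · simp
    · refine Finset.sum_congr rfl fun e he => ?_
      have heR := Finset.mem_of_mem_erase he
      have hee : ∀ i, precedeProb φ V x (N + 1) (R.erase e) i =
          precedeProb φ V x N ((R.erase w).erase e) i := by
        intro i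
        rw [Finset.erase_right_comm]
        refine ih (R.erase e) i ?_ ?_ ?_ ?_
        · rw [Finset.card_erase_of_mem (Finset.mem_of_mem_erase heR), hR]; rfl
        · exact Finset.mem_erase.2 ⟨(Finset.ne_of_mem_erase he).symm, hx⟩
        · exact Finset.mem_erase.2 ⟨(Finset.ne_of_mem_erase heR).symm, hw⟩
        · exact fun y hy => hmin y (Finset.mem_of_mem_erase hy)
      rw [hee, hee, hrk e heR, pow_succ', mul_assoc]

end RelRank

/-! ### Geometric decay of the number of elements of V before x -/

section RatioBound

variable {α : Type*} [LinearOrder α] {φ : ℝ} {V : Finset α} {x : α}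

/-- The estimate behind `precedeProb_le_mul_succ`, for the choice of the first element. -/
theorem pow_relRank_le_ratioBound_mul (hφ : 0 < φ) (hφ1 : φ < 1) (hxV : x ∉ V) (N : ℕ)
    (hN : φ ^ 2 * geomSum φ N ≤ 1) (R : Finset α) (hR : R.card = N + 2) (hx : x ∈ R) {a : α}
    (haR : a ∈ R) (haV : a ∈ V) (hax : a < x) (hmin : ∀ y ∈ R, a ≤ y) :
    φ ^ relRank R x ≤ ratioBound φ N *
      ∑ v ∈ R ∩ V, φ ^ relRank R v * precedeProb φ V x (N + 1) (R.erase v) 0 := by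
  set T := (R.erase a).erase x with hT
  set b := relRank (R.erase a) x with hb
  set L := (R ∩ V).card with hL
  have hxa : x ∈ R.erase a := Finset.mem_erase.2 ⟨hax.ne', hx⟩
  have hrx : relRank R x = b + 1 := relRank_erase_of_lt haR hax
  have hTcard : T.card = N := by
    rw [hT, Finset.card_erase_of_mem hxa, Finset.card_erase_of_mem haR, hR]; rfl
  have hmemT : ∀ e, e ∈ T ↔ e ≠ x ∧ e ≠ a ∧ e ∈ R := by
    intro e; rw [hT, Finset.mem_erase, Finset.mem_erase]
  have haT : ∀ e ∈ T, a < e := fun e he =>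
    lt_of_le_of_ne (hmin e ((hmemT e).1 he).2.2) ((hmemT e).1 he).2.1.symm
  have hLpos : 0 < L := Finset.card_pos.2 ⟨a, Finset.mem_inter.2 ⟨haR, haV⟩⟩
  have hRV : R ∩ V = insert a (T ∩ V) := by
    ext e
    simp only [Finset.mem_inter, Finset.mem_insert, hmemT]
    constructor
    · rintro ⟨h1, h2⟩
      by_cases h : e = a
      · exact Or.inl h
      · exact Or.inr ⟨⟨fun h' => hxV (h' ▸ h2), h, h1⟩, h2⟩
    · rintro (rfl | h)
      · exact ⟨haR, haV⟩
      · exact ⟨h.1.2.2, h.2⟩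
  have haTV : a ∉ T ∩ V := by simp [hmemT]
  have hLT : L = (T ∩ V).card + 1 := by rw [hL, hRV, Finset.card_insert_of_notMem haTV]
  have herase : ∀ v ∈ R, v ∈ V → ((R.erase v) ∩ V).card + 1 = L := by
    intro v hv hvV
    rw [Finset.erase_inter, Finset.card_erase_add_one (Finset.mem_inter.2 ⟨hv, hvV⟩)]
  -- elements of `V`
  have hv : ∀ v ∈ T ∩ V, φ ^ b * (φ ^ 3 * φ ^ relRank T v) ≤
      geomSum φ L * (φ ^ relRank R v * precedeProb φ V x (N + 1) (R.erase v) 0) := by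
    intro v hv
    obtain ⟨hvT, hvV⟩ := Finset.mem_inter.1 hv
    obtain ⟨hvx, hva, hvR⟩ := (hmemT v).1 hvT
    have h1 := le_precedeProb_zero hφ hφ1.le hxV (N + 1) (R.erase v)
      (by rw [Finset.card_erase_of_mem hvR, hR]; rfl) (Finset.mem_erase.2 ⟨hvx.symm, hx⟩)
    rw [herase v hvR hvV] at h1
    have h2 := relRank_add_relRank_erase_le hx hvR hvx
    have h3 : relRank (R.erase x) v = relRank T v + 1 := by
      rw [hT, Finset.erase_right_comm]
      exact relRank_erase_of_lt (Finset.mem_erase.2 ⟨hax.ne, haR⟩) (haT v hvT)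
    -- The 3 counts a below v, a below x, and the exchange of v and x.
    have h4 : φ ^ (b + 3 + relRank T v) ≤ φ ^ (relRank R v + relRank (R.erase v) x) :=
      pow_le_pow_of_le_one hφ.le hφ1.le (by omega)
    calc φ ^ b * (φ ^ 3 * φ ^ relRank T v) = φ ^ (b + 3 + relRank T v) := by ring
      _ ≤ φ ^ relRank R v * φ ^ relRank (R.erase v) x := by rw [← pow_add]; exact h4
      _ ≤ φ ^ relRank R v * (geomSum φ L * precedeProb φ V x (N + 1) (R.erase v) 0) := by
          gcongr
      _ = _ := by ring
  -- the other elements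
  have hw : ∀ w ∈ T \ V, φ ^ b * (φ * φ ^ relRank T w) ≤ geomSum φ L *
      (φ ^ relRank (R.erase a) w * precedeProb φ V x N ((R.erase a).erase w) 0) := by
    intro w hw
    obtain ⟨hwT, hwV⟩ := Finset.mem_sdiff.1 hw
    obtain ⟨hwx, hwa, hwR⟩ := (hmemT w).1 hwT
    have hwRa : w ∈ R.erase a := Finset.mem_erase.2 ⟨hwa, hwR⟩
    have h1 := le_precedeProb_zero hφ hφ1.le hxV N ((R.erase a).erase w)
      (by rw [Finset.card_erase_of_mem hwRa, Finset.card_erase_of_mem haR, hR]; rfl)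
      (Finset.mem_erase.2 ⟨hwx.symm, hxa⟩)
    rw [Finset.erase_inter w, Finset.erase_eq_of_notMem (s := R.erase a ∩ V)
      (fun h => hwV (Finset.mem_inter.1 h).2), herase a haR haV] at h1
    have h2 := relRank_add_relRank_erase_le hxa hwRa hwx
    rw [← hT] at h2
    have h4 : φ ^ (b + 1 + relRank T w) ≤
        φ ^ (relRank (R.erase a) w + relRank ((R.erase a).erase w) x) :=
      pow_le_pow_of_le_one hφ.le hφ1.le (by omega)
    calc φ ^ b * (φ * φ ^ relRank T w) = φ ^ (b + 1 + relRank T w) := by ring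
      _ ≤ φ ^ relRank (R.erase a) w * φ ^ relRank ((R.erase a).erase w) x := by
          rw [← pow_add]; exact h4
      _ ≤ φ ^ relRank (R.erase a) w *
          (geomSum φ L * precedeProb φ V x N ((R.erase a).erase w) 0) := by gcongr
      _ = _ := by ring
  have hsplit : ∑ e ∈ T \ V, φ ^ relRank T e + ∑ e ∈ T ∩ V, φ ^ relRank T e = geomSum φ N := by
    rw [add_comm, Finset.sum_inter_add_sum_sdiff, sum_pow_relRank, hTcard]
  have hvsum := Finset.sum_le_sum hv
  have hwsum := Finset.sum_le_sum hw
  rw [← Finset.mul_sum, ← Finset.mul_sum, ← Finset.mul_sum] at hvsum hwsum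
  -- For v = a one further choice is expanded: x at once, or first some w outside V.
  have hstep := geomSum_mul_precedeProb_zero (V := V) (x := x) hφ N (R.erase a)
  rw [← hT, ← hb] at hstep
  have hra : relRank R a = 0 := by
    rw [relRank, Finset.card_eq_zero, Finset.filter_eq_empty_iff]
    exact fun y hy => (hmin y hy).not_gt
  rw [hRV, Finset.sum_insert haTV, hra, pow_zero, one_mul]
  have hLg : 0 < geomSum φ L := by
    obtain ⟨k, hk⟩ := Nat.exists_eq_succ_of_ne_zero hLpos.ne'
    rw [hk]; exact geomSum_succ_pos hφ k
  have hN1 := geomSum_succ_pos hφ N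
  have hGN := geomSum_nonneg hφ N
  have hSw : 0 ≤ ∑ e ∈ T \ V, φ ^ relRank T e := Finset.sum_nonneg fun _ _ => by positivity
  have hSv : 0 ≤ ∑ e ∈ T ∩ V, φ ^ relRank T e := Finset.sum_nonneg fun _ _ => by positivity
  -- The two sums on the right add up to [N] without their coefficients. If T lies in V, then L ≤ N
  -- + 1 suffices; otherwise L ≤ N, and φ² [N] ≤ 1 absorbs the coefficient of the sum outside V.
  have hcomb : φ ^ 2 * geomSum φ N * geomSum φ L ≤ ∑ e ∈ T \ V, φ ^ relRank T e +
      φ ^ 2 * geomSum φ (N + 1) * ∑ e ∈ T ∩ V, φ ^ relRank T e := by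
    by_cases hW : T \ V = ∅
    · have hle : L ≤ N + 1 := by
        rw [hLT, ← hTcard]
        exact Nat.succ_le_succ (Finset.card_le_card Finset.inter_subset_left)
      rw [hW, Finset.sum_empty, zero_add] at hsplit ⊢
      rw [hsplit]
      have := mul_le_mul_of_nonneg_left (geomSum_mono hφ hle)
        (mul_nonneg (sq_nonneg φ) hGN)
      linarith
    · have hle : L ≤ N := by
        rw [hLT, ← hTcard]
        refine Finset.card_lt_card ⟨Finset.inter_subset_left, fun h => hW ?_⟩
        exact Finset.sdiff_eq_empty_iff_subset.2 fun e he => (Finset.mem_inter.1 (h he)).2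
      have h1 := mul_le_mul_of_nonneg_left (geomSum_mono hφ hle)
        (mul_nonneg (sq_nonneg φ) hGN)
      have h2 := mul_le_mul_of_nonneg_right hN hSw
      have h3 := mul_le_mul_of_nonneg_right (mul_le_mul_of_nonneg_left
        (geomSum_mono hφ (Nat.le_succ N)) (sq_nonneg φ)) hSv
      have h4 : φ ^ 2 * geomSum φ N * geomSum φ N = φ ^ 2 * geomSum φ N *
          ∑ e ∈ T \ V, φ ^ relRank T e + φ ^ 2 * geomSum φ N * ∑ e ∈ T ∩ V, φ ^ relRank T e := by
        rw [← mul_add, hsplit]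
      linarith
  set Sw := ∑ e ∈ T \ V, φ ^ relRank T e
  set Sv := ∑ e ∈ T ∩ V, φ ^ relRank T e
  set K := ∑ v ∈ T ∩ V, φ ^ relRank R v * precedeProb φ V x (N + 1) (R.erase v) 0
  set F := precedeProb φ V x (N + 1) (R.erase a) 0
  have hmain : φ ^ b * (1 + φ ^ 3 * geomSum φ N) ≤ geomSum φ (N + 1) * (F + K) := by
    refine le_of_mul_le_mul_left ?_ hLg
    have h1 : geomSum φ L * (geomSum φ (N + 1) * (F + K)) =
        geomSum φ L * (geomSum φ (N + 1) * F) + geomSum φ (N + 1) * (geomSum φ L * K) := by ring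
    rw [h1, hstep]
    have h2 := mul_le_mul_of_nonneg_left hvsum hN1.le
    have h3 := mul_le_mul_of_nonneg_left hcomb (mul_pos (pow_pos hφ b) hφ).le
    have h4 : geomSum φ L * (φ ^ b * (1 + φ ^ 3 * geomSum φ N)) = geomSum φ L * φ ^ b +
      φ ^ b * φ * (φ ^ 2 * geomSum φ N * geomSum φ L) := by ring
    have h5 : φ ^ b * φ * (Sw + φ ^ 2 * geomSum φ (N + 1) * Sv) =
      φ ^ b * (φ * Sw) + geomSum φ (N + 1) * (φ ^ b * (φ ^ 3 * Sv)) := by ring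
    rw [h4, mul_add (geomSum φ L) (φ ^ b)]
    linarith
  rw [hrx, ratioBound, div_mul_eq_mul_div, le_div_iff₀ (ratioBound_den_pos hφ N), pow_succ]
  have := mul_le_mul_of_nonneg_left hmain hφ.le
  linarith

/-- If fewer elements of `V` are chosen before `x` than there are elements of `V` below `x`, then
one more such element is likelier by a factor. -/
theorem precedeProb_le_mul_succ (hφ : 0 < φ) (hφ1 : φ < 1) (hxV : x ∉ V) (M : ℕ)
    (hM : φ ^ 2 * geomSum φ M ≤ 1) (N : ℕ) (R : Finset α) (j : ℕ) (hR : R.card = N)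
    (hNM : N ≤ M + 2) (hx : x ∈ R) (hj : j < ((R ∩ V).filter (· < x)).card) :
    precedeProb φ V x N R j ≤ ratioBound φ M * precedeProb φ V x N R (j + 1) := by
  induction N generalizing R j with
  | zero => simp [precedeProb]
  | succ N ih =>
    have hw : ∀ w ∈ (R.erase x) \ V, precedeProb φ V x N (R.erase w) j ≤
        ratioBound φ M * precedeProb φ V x N (R.erase w) (j + 1) := by
      intro w hw
      simp only [Finset.mem_sdiff, Finset.mem_erase] at hw
      refine ih _ _ (by rw [Finset.card_erase_of_mem hw.1.2, hR]; rfl) (by omega)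
        (Finset.mem_erase.2 ⟨hw.1.1.symm, hx⟩) ?_
      rwa [Finset.erase_inter, Finset.erase_eq_of_notMem fun h => hw.2 (Finset.mem_inter.1 h).2]
    have hpos := geomSum_succ_pos hφ N
    obtain _ | j := j
    · obtain ⟨v, hv⟩ := Finset.card_pos.1 hj
      simp only [Finset.mem_filter, Finset.mem_inter] at hv
      obtain ⟨a, haR, hmin⟩ := Finset.exists_min_image R id ⟨x, hx⟩
      have hax : a < x := lt_of_le_of_lt (hmin v hv.1.1) hv.2
      have hcard := Finset.one_lt_card.2 ⟨a, haR, x, hx, hax.ne⟩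
      -- The core estimate needs the minimum of R to lie in V; a minimum outside V is deleted and
      -- the induction hypothesis applies.
      by_cases haV : a ∈ V
      · obtain _ | N := N
        · omega
        refine le_of_mul_le_mul_left ?_ hpos
        rw [mul_left_comm, geomSum_mul_precedeProb_zero hφ, geomSum_mul_precedeProb_succ hφ hxV,
          mul_add, add_comm, Finset.mul_sum]
        refine add_le_add (Finset.sum_le_sum fun w hw' => ?_) ?_
        · rw [mul_left_comm]
          exact mul_le_mul_of_nonneg_left (hw w hw') (pow_pos hφ _).le
        · refine (pow_relRank_le_ratioBound_mul hφ hφ1 hxV N ?_ R hR hx haR haV hax hmin).trans ?_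
          · exact (mul_le_mul_of_nonneg_left (geomSum_mono hφ (by omega)) (sq_nonneg φ)).trans hM
          · refine mul_le_mul_of_nonneg_right (ratioBound_mono hφ hφ1.le (by omega)) ?_
            exact Finset.sum_nonneg fun v _ =>
              mul_nonneg (pow_pos hφ _).le (precedeProb_nonneg hφ _ _ _)
      · rw [precedeProb_erase_min hφ haV N R _ hR hx haR hax.ne hmin,
          precedeProb_erase_min hφ haV N R _ hR hx haR hax.ne hmin]
        exact hw a (Finset.mem_sdiff.2 ⟨Finset.mem_erase.2 ⟨hax.ne, haR⟩, haV⟩)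
    · refine le_of_mul_le_mul_left ?_ hpos
      rw [mul_left_comm, geomSum_mul_precedeProb_succ hφ hxV, geomSum_mul_precedeProb_succ hφ hxV,
        mul_add, Finset.mul_sum, Finset.mul_sum]
      refine add_le_add (Finset.sum_le_sum fun w hw' => ?_) (Finset.sum_le_sum fun v hv => ?_)
      · rw [mul_left_comm]
        exact mul_le_mul_of_nonneg_left (hw w hw') (pow_pos hφ _).le
      · rw [mul_left_comm]
        refine mul_le_mul_of_nonneg_left ?_ (pow_pos hφ _).le
        obtain ⟨hvR, hvV⟩ := Finset.mem_inter.1 hv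
        refine ih _ _ (by rw [Finset.card_erase_of_mem hvR, hR]; rfl) (by omega)
          (Finset.mem_erase.2 ⟨fun h => hxV (h ▸ hvV), hx⟩) ?_
        rw [Finset.erase_inter, Finset.filter_erase]
        -- Removing v lowers the number of elements of V below x by at most one, just as j drops by
        -- one.
        exact lt_of_lt_of_le (by omega) Finset.pred_card_le_card_erase

end RatioBound

/-! ### Permutations and their first element -/

/-- The number of inversions of a permutation. -/
def invCount {N : ℕ} (π : Equiv.Perm (Fin N)) : ℕ :=
  ∑ p, ∑ q, if p < q ∧ π q < π p then 1 else 0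

/-- The ranking of `N + 1` elements in which `e` comes first and the others are ranked by `τ`. -/
def insertFirst {N : ℕ} (e : Fin (N + 1)) (τ : Equiv.Perm (Fin N)) : Equiv.Perm (Fin (N + 1)) :=
  (finSuccEquiv' e).trans (τ.optionCongr.trans (finSuccEquiv' 0).symm)

@[simp]
theorem insertFirst_self {N : ℕ} (e : Fin (N + 1)) (τ : Equiv.Perm (Fin N)) :
    insertFirst e τ e = 0 := by
  simp [insertFirst]

@[simp]
theorem insertFirst_succAbove {N : ℕ} (e : Fin (N + 1)) (τ : Equiv.Perm (Fin N)) (p : Fin N) :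
    insertFirst e τ (e.succAbove p) = (τ p).succ := by
  simp [insertFirst]

theorem insertFirst_bijective (N : ℕ) : Function.Bijective
    (fun z : Fin (N + 1) × Equiv.Perm (Fin N) => insertFirst z.1 z.2) := by
  rw [Fintype.bijective_iff_injective_and_card]
  refine ⟨?_, ?_⟩
  · rintro ⟨e, τ⟩ ⟨e', τ'⟩ h
    simp only at h
    have he : e = e' := by
      apply (insertFirst e τ).injective
      rw [insertFirst_self]
      rw [h, insertFirst_self]
    subst he
    congr 1
    ext p
    have := congrArg (fun π => π (e.succAbove p)) h
    simp only [insertFirst_succAbove, Fin.succ_inj] at this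
    rw [this]
  · simp [Fintype.card_perm, Nat.factorial_succ]

theorem sum_perm_succ {N : ℕ} {M : Type*} [AddCommMonoid M]
    (f : Equiv.Perm (Fin (N + 1)) → M) :
    ∑ π, f π = ∑ e, ∑ τ, f (insertFirst e τ) := by
  rw [← Fintype.sum_prod_type' (fun e τ => f (insertFirst e τ))]
  exact (Fintype.sum_bijective _ (insertFirst_bijective N) _ _ fun _ => rfl).symm

theorem sum_succAbove_lt {N : ℕ} (e : Fin (N + 1)) :
    (∑ p : Fin N, if e.succAbove p < e then 1 else 0) = e.val := by
  have h := Fin.sum_univ_succAbove (fun p => if p < e then 1 else 0) e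
  rw [if_neg (lt_irrefl e), zero_add] at h
  rw [← h, ← Finset.card_filter, Finset.filter_gt_eq_Iio, Fin.card_Iio]

/-- The first element e is inverted exactly with the e smaller elements. -/
theorem invCount_insertFirst {N : ℕ} (e : Fin (N + 1)) (τ : Equiv.Perm (Fin N)) :
    invCount (insertFirst e τ) = e.val + invCount τ := by
  rw [invCount, Fin.sum_univ_succAbove _ e, ← sum_succAbove_lt e, invCount,
    ← Finset.sum_add_distrib]
  simp only [insertFirst_self, Fin.not_lt_zero, and_false, if_false, Finset.sum_const_zero,
    zero_add]
  refine Finset.sum_congr rfl fun p _ => ?_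
  rw [Fin.sum_univ_succAbove _ e]
  simp

theorem sum_pow_invCount (φ : ℝ) (N : ℕ) :
    ∑ π : Equiv.Perm (Fin N), φ ^ invCount π = ∏ k ∈ Finset.range N, geomSum φ (k + 1) := by
  induction N with
  | zero => simp [invCount]
  | succ N ih =>
    rw [sum_perm_succ, Finset.prod_range_succ, ← ih, mul_comm, geomSum,
      ← Fin.sum_univ_eq_sum_range, Finset.sum_mul]
    refine Finset.sum_congr rfl fun e _ => ?_
    rw [Finset.mul_sum]
    refine Finset.sum_congr rfl fun τ _ => ?_
    rw [invCount_insertFirst, pow_add]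

theorem card_filter_insertFirst {N : ℕ} (e : Fin (N + 1)) (τ : Equiv.Perm (Fin N))
    (S : Fin (N + 1) → Prop) [DecidablePred S] (p₀ : Fin N) :
    (Finset.univ.filter fun p => S p ∧ insertFirst e τ p <
      insertFirst e τ (e.succAbove p₀)).card = (if S e then 1 else 0) +
      (Finset.univ.filter fun p => S (e.succAbove p) ∧ τ p < τ p₀).card := by
  rw [Finset.card_filter, Finset.card_filter, Fin.sum_univ_succAbove _ e]
  simp

theorem relRank_image {N : ℕ} {α : Type*} [LinearOrder α] {ι : Fin N → α} (hι : StrictMono ι)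
    (e : Fin N) : relRank (Finset.univ.image ι) (ι e) = e.val := by
  rw [relRank, Finset.filter_image, Finset.card_image_of_injective _ hι.injective]
  simp only [hι.lt_iff_lt]
  rw [Finset.filter_gt_eq_Iio, Fin.card_Iio]

theorem image_succAbove {N : ℕ} {α : Type*} [LinearOrder α] {ι : Fin (N + 1) → α}
    (hι : StrictMono ι) (e : Fin (N + 1)) :
    Finset.univ.image (fun p => ι (e.succAbove p)) = (Finset.univ.image ι).erase (ι e) := by
  ext y
  simp only [Finset.mem_image, Finset.mem_univ, true_and, Finset.mem_erase]
  constructor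
  · rintro ⟨p, rfl⟩
    exact ⟨fun h => Fin.succAbove_ne e p (hι.injective h), _, rfl⟩
  · rintro ⟨h, p, rfl⟩
    obtain ⟨p', rfl⟩ := Fin.exists_succAbove_eq (fun h' : p = e => h (by rw [h']))
    exact ⟨p', rfl⟩

/-- Sequential choice describes the Mallows model. -/
theorem sum_pow_invCount_of_card_eq {α : Type*} [LinearOrder α] {φ : ℝ} (hφ : 0 < φ)
    {V : Finset α} {x : α} (N : ℕ) (ι : Fin N → α) (hι : StrictMono ι)
    (p₀ : Fin N) (hx : ι p₀ = x) (j : ℕ) :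
    (∑ π : Equiv.Perm (Fin N),
      if (Finset.univ.filter fun p => ι p ∈ V ∧ π p < π p₀).card = j
        then φ ^ invCount π else 0) =
    (∏ k ∈ Finset.range N, geomSum φ (k + 1)) *
      precedeProb φ V x N (Finset.univ.image ι) j := by
  induction N generalizing j with
  | zero => exact p₀.elim0
  | succ N ih =>
    have hG := (geomSum_succ_pos hφ N).ne'
    rw [sum_perm_succ, Fin.sum_univ_succAbove _ p₀, Finset.prod_range_succ, precedeProb, mul_assoc,
      mul_div_cancel₀ _ hG, mul_add]
    congr 1
    · simp only [insertFirst_self, Fin.not_lt_zero, and_false, Finset.filter_false,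
        Finset.card_empty, invCount_insertFirst, pow_add]
      rw [← hx, relRank_image hι]
      by_cases hj : j = 0
      · subst hj
        simp only [if_true]
        rw [← Finset.mul_sum, sum_pow_invCount, mul_comm]
      · simp [hj, Ne.symm hj]
    · rw [← hx, ← image_succAbove hι p₀, Finset.sum_image
        (fun p _ q _ h => Fin.succAbove_right_injective (hι.injective h)), Finset.mul_sum]
      refine Finset.sum_congr rfl fun i _ => ?_
      -- Once e ≠ p₀ is chosen, the rest is reindexed by `Fin N`, with p₀ at position `i.predAbove
      -- p₀`; the general embedding ι allows this.
      set e := p₀.succAbove i with he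
      have hp₀ : e.succAbove (i.predAbove p₀) = p₀ := Fin.succAbove_succAbove_predAbove p₀ i
      have hιe : StrictMono fun p => ι (e.succAbove p) :=
        hι.comp (Fin.strictMono_succAbove e)
      have hrec := ih (fun p => ι (e.succAbove p)) hιe (i.predAbove p₀) (by
        simp only [hp₀, hx])
      rw [image_succAbove hι e] at hrec
      rw [relRank_image hι]
      have hcount : ∀ τ : Equiv.Perm (Fin N),
          (Finset.univ.filter fun p => ι p ∈ V ∧ insertFirst e τ p < insertFirst e τ p₀).card =
          (if ι e ∈ V then 1 else 0) + (Finset.univ.filter fun p =>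
            ι (e.succAbove p) ∈ V ∧ τ p < τ (i.predAbove p₀)).card := by
        intro τ
        have := card_filter_insertFirst e τ (fun p => ι p ∈ V) (i.predAbove p₀)
        rwa [hp₀] at this
      simp only [hcount, invCount_insertFirst, pow_add]
      rw [hx]
      by_cases hV : ι e ∈ V
      · simp only [hV, if_true]
        obtain _ | j := j
        · simp
        · simp only [Nat.add_sub_cancel, Nat.succ_ne_zero, if_false]
          rw [mul_left_comm, ← hrec j, Finset.mul_sum]
          refine Finset.sum_congr rfl fun τ _ => ?_
          rw [mul_ite, mul_zero, add_comm 1]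
          simp only [Nat.add_right_cancel_iff]
      · simp only [hV, if_false, zero_add]
        rw [mul_left_comm, ← hrec j, Finset.mul_sum]
        refine Finset.sum_congr rfl fun τ _ => ?_
        rw [mul_ite, mul_zero]

/-! ### The number of elements of a set ranked before a given element -/

/-- The total weight of the rankings in which exactly `j` elements of `V` come before `x`. -/
noncomputable def precedeWeight {n : ℕ} (φ : ℝ) (V : Finset (Fin n)) (x : Fin n) (j : ℕ) : ℝ :=
  ∑ π : Equiv.Perm (Fin n), if (V.filter fun p => π p < π x).card = j
    then φ ^ invCount π else 0

theorem precedeWeight_nonneg {n : ℕ} {φ : ℝ} (hφ : 0 < φ) (V : Finset (Fin n)) (x : Fin n)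
    (j : ℕ) : 0 ≤ precedeWeight φ V x j :=
  Finset.sum_nonneg fun _ _ => by split_ifs <;> positivity

theorem precedeWeight_le_mul_succ {n : ℕ} {φ : ℝ} (hφ : 0 < φ) (hφ1 : φ < 1)
    (hn : φ ^ 2 * geomSum φ (n - 2) ≤ 1) {V : Finset (Fin n)} {x : Fin n} (hxV : x ∉ V) {j : ℕ}
    (hj : j < (V.filter (· < x)).card) :
    precedeWeight φ V x j ≤ ratioBound φ (n - 2) * precedeWeight φ V x (j + 1) := by
  have h : ∀ i, precedeWeight φ V x i = (∏ k ∈ Finset.range n, geomSum φ (k + 1)) *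
      precedeProb φ V x n Finset.univ i := by
    intro i
    have := sum_pow_invCount_of_card_eq (V := V) (x := x) hφ n id strictMono_id x rfl i
    rw [Finset.image_id] at this
    rw [← this, precedeWeight]
    refine Finset.sum_congr rfl fun π _ => ?_
    congr 3
    ext p
    simp
  rw [h, h, mul_left_comm]
  refine mul_le_mul_of_nonneg_left ?_ (Finset.prod_nonneg fun k _ => geomSum_nonneg hφ _)
  exact precedeProb_le_mul_succ hφ hφ1 hxV (n - 2) hn n _ j (by simp) (by omega)
    (Finset.mem_univ x) (by simpa using hj)

/-- The reversal of both the elements and the ranks. -/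
def reverse {n : ℕ} (π : Equiv.Perm (Fin n)) : Equiv.Perm (Fin n) :=
  Fin.revPerm.trans (π.trans Fin.revPerm)

theorem reverse_apply {n : ℕ} (π : Equiv.Perm (Fin n)) (p : Fin n) :
    reverse π p = (π p.rev).rev := rfl

theorem reverse_involutive (n : ℕ) : Function.Involutive (reverse (n := n)) := fun π => by
  ext p
  simp [reverse_apply]

theorem invCount_reverse {n : ℕ} (π : Equiv.Perm (Fin n)) : invCount (reverse π) = invCount π := by
  rw [invCount, ← Equiv.sum_comp Fin.revPerm, invCount]
  simp_rw [← Equiv.sum_comp Fin.revPerm (fun q => if _ ∧ reverse π q < _ then 1 else 0)]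
  rw [Finset.sum_comm]
  simp [reverse_apply, Fin.rev_lt_rev]

/-- Reversal keeps the inversion number and exchanges the elements of V before x with those after
it. -/
theorem precedeWeight_rev {n : ℕ} (φ : ℝ) {V : Finset (Fin n)} {x : Fin n} (hxV : x ∉ V) {i : ℕ}
    (hi : i ≤ V.card) :
    precedeWeight φ (V.image Fin.rev) x.rev i = precedeWeight φ V x (V.card - i) := by
  rw [precedeWeight, ← (reverse_involutive n).bijective.sum_comp, precedeWeight]
  refine Finset.sum_congr rfl fun π _ => ?_
  rw [invCount_reverse]
  have h1 : ((V.image Fin.rev).filter fun p => reverse π p < reverse π x.rev).card =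
      (V.filter fun p => ¬ π p < π x).card := by
    rw [Finset.filter_image, Finset.card_image_of_injective _ Fin.rev_injective]
    congr 1
    refine Finset.filter_congr fun p hp => ?_
    have hne : π x ≠ π p := fun h => hxV (π.injective h ▸ hp)
    simp only [reverse_apply, Fin.rev_rev, Fin.rev_lt_rev, not_lt]
    exact hne.le_iff_lt.symm
  have h2 := Finset.card_filter_add_card_filter_not (s := V) (fun p => π p < π x)
  rw [h1]
  have h3 : (V.filter fun p => ¬ π p < π x).card = i ↔
      (V.filter fun p => π p < π x).card = V.card - i := by omega
  simp only [h3]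

theorem precedeWeight_succ_le_mul {n : ℕ} {φ : ℝ} (hφ : 0 < φ) (hφ1 : φ < 1)
    (hn : φ ^ 2 * geomSum φ (n - 2) ≤ 1) {V : Finset (Fin n)} {x : Fin n} (hxV : x ∉ V) {j : ℕ}
    (hj : (V.filter (· < x)).card ≤ j) :
    precedeWeight φ V x (j + 1) ≤ ratioBound φ (n - 2) * precedeWeight φ V x j := by
  by_cases hjV : j + 1 ≤ V.card
  · have h1 := precedeWeight_rev φ hxV (i := V.card - (j + 1)) (by omega)
    have h2 := precedeWeight_rev φ hxV (i := V.card - (j + 1) + 1) (by omega)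
    rw [show V.card - (V.card - (j + 1)) = j + 1 by omega] at h1
    rw [show V.card - (V.card - (j + 1) + 1) = j by omega] at h2
    rw [← h1, ← h2]
    refine precedeWeight_le_mul_succ hφ hφ1 hn ?_ ?_
    · simpa using hxV
    · rw [Finset.filter_image, Finset.card_image_of_injective _ Fin.rev_injective]
      simp only [Fin.rev_lt_rev]
      have h3 := Finset.card_filter_add_card_filter_not (s := V) (fun p => p < x)
      have h4 : V.filter (fun p => ¬ p < x) = V.filter (fun p => x < p) := by
        refine Finset.filter_congr fun p hp => ?_
        have hne : x ≠ p := fun h => hxV (h ▸ hp)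
        rw [not_lt]
        exact hne.le_iff_lt
      rw [h4] at h3
      omega
  · have : precedeWeight φ V x (j + 1) = 0 := by
      refine Finset.sum_eq_zero fun π _ => if_neg ?_
      have := Finset.card_filter_le V (fun p => π p < π x)
      omega
    rw [this]
    exact mul_nonneg (ratioBound_pos hφ _).le (precedeWeight_nonneg hφ _ _ _)

/-! ### The Lehmer code under the Mallows model -/

/-- Naming elements by their σ₀-rank moves the centre of the model to the identity. -/
theorem kendallTau_eq_invCount {n : ℕ} (σ₀ τ : Ranking n) :
    kendallTau σ₀ τ = invCount (σ₀.symm.trans τ) := by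
  rw [invCount, ← Equiv.sum_comp σ₀, kendallTau, Finset.card_filter, Fintype.sum_prod_type]
  refine Finset.sum_congr rfl fun x _ => Eq.trans ?_ (Equiv.sum_comp σ₀ _)
  refine Finset.sum_congr rfl fun y _ => ?_
  simp [and_comm]

/-- The total weight of the rankings whose Lehmer code is `i` at `x`. -/
noncomputable def lehmerWeight {n : ℕ} (σ₀ : Ranking n) (φ : ℝ) (x : Fin n) (i : ℕ) : ℝ :=
  ∑ τ : Ranking n, if (lehmerCode τ x).val = i then φ ^ kendallTau σ₀ τ else 0

theorem lehmerWeight_nonneg {n : ℕ} (σ₀ : Ranking n) {φ : ℝ} (hφ : 0 < φ) (x : Fin n) (i : ℕ) :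
    0 ≤ lehmerWeight σ₀ φ x i :=
  Finset.sum_nonneg fun _ _ => by split_ifs <;> positivity

theorem sum_lehmerWeight {n : ℕ} (σ₀ : Ranking n) (φ : ℝ) (x : Fin n) :
    ∑ i ∈ Finset.range (x.val + 1), lehmerWeight σ₀ φ x i = mallowsZ σ₀ φ := by
  simp only [lehmerWeight]
  rw [Finset.sum_comm, mallowsZ]
  refine Finset.sum_congr rfl fun τ _ => ?_
  rw [Finset.sum_ite_eq, if_pos (Finset.mem_range.2 (lehmerCode τ x).is_lt)]

theorem card_filter_add_lehmerCode {n : ℕ} (σ₀ τ : Ranking n) (x : Fin n) :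
    (((Finset.Iio x).image σ₀).filter fun p =>
      (σ₀.symm.trans τ) p < (σ₀.symm.trans τ) (σ₀ x)).card + (lehmerCode τ x).val = x.val := by
  rw [Finset.filter_image, Finset.card_image_of_injective _ σ₀.injective]
  simp only [Equiv.trans_apply, Equiv.symm_apply_apply]
  have h1 : (lehmerCode τ x).val = ((Finset.Iio x).filter fun y => ¬ τ y < τ x).card := by
    change (lehmerSet τ x).card = _
    congr 1
    ext y
    simp only [lehmerSet, Finset.mem_filter, Finset.mem_univ, true_and, Finset.mem_Iio, not_lt]
    refine and_congr_right fun hy => ?_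
    have hne : τ x ≠ τ y := fun h => hy.ne' (τ.injective h)
    exact hne.le_iff_lt.symm
  rw [h1, Finset.card_filter_add_card_filter_not, Fin.card_Iio]

theorem lehmerWeight_eq_precedeWeight {n : ℕ} (σ₀ : Ranking n) (φ : ℝ) (x : Fin n) {i : ℕ}
    (hi : i ≤ x.val) :
    lehmerWeight σ₀ φ x i =
      precedeWeight φ ((Finset.Iio x).image σ₀) (σ₀ x) (x.val - i) := by
  have hbij : Function.Bijective fun τ : Ranking n => σ₀.symm.trans τ :=
    (Equiv.equivCongr σ₀ (Equiv.refl (Fin n))).bijective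
  rw [precedeWeight, ← hbij.sum_comp, lehmerWeight]
  refine Finset.sum_congr rfl fun τ _ => ?_
  have h := card_filter_add_lehmerCode σ₀ τ x
  rw [kendallTau_eq_invCount]
  refine if_congr ?_ rfl rfl
  omega

theorem lehmerWeight_eq_zero {n : ℕ} (σ₀ : Ranking n) (φ : ℝ) (x : Fin n) {i : ℕ}
    (hi : x.val < i) : lehmerWeight σ₀ φ x i = 0 :=
  Finset.sum_eq_zero fun τ _ => if_neg (by have := (lehmerCode τ x).is_lt; omega)

section Unimodal

variable {n : ℕ} (σ₀ : Ranking n) {φ : ℝ} (hφ : 0 < φ) (hφ1 : φ < 1)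
  (hn : φ ^ 2 * geomSum φ (n - 2) ≤ 1) (x : Fin n)

theorem card_filter_lt_add_lehmerCode :
    (((Finset.Iio x).image σ₀).filter (· < σ₀ x)).card + (lehmerCode σ₀ x).val = x.val := by
  have h := card_filter_add_lehmerCode σ₀ σ₀ x
  rw [Equiv.symm_trans_self] at h
  exact h

theorem notMem_image_Iio : σ₀ x ∉ (Finset.Iio x).image σ₀ := by
  simp

include hφ hφ1 hn in
-- A larger code means fewer elements of V before x, so decay above the mode of the code is decay
-- below the mode of the count.
theorem lehmerWeight_succ_le {i : ℕ} (hi : (lehmerCode σ₀ x).val ≤ i) :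
    lehmerWeight σ₀ φ x (i + 1) ≤ ratioBound φ (n - 2) * lehmerWeight σ₀ φ x i := by
  by_cases h : i + 1 ≤ x.val
  · rw [lehmerWeight_eq_precedeWeight σ₀ φ x h, lehmerWeight_eq_precedeWeight σ₀ φ x (by omega),
      show x.val - i = x.val - (i + 1) + 1 by omega]
    refine precedeWeight_le_mul_succ hφ hφ1 hn (notMem_image_Iio σ₀ x) ?_
    have := card_filter_lt_add_lehmerCode σ₀ x
    omega
  · rw [lehmerWeight_eq_zero σ₀ φ x (by omega)]
    exact mul_nonneg (ratioBound_pos hφ _).le (lehmerWeight_nonneg σ₀ hφ x i)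

include hφ hφ1 hn in
theorem lehmerWeight_le_succ {i : ℕ} (hi : i < (lehmerCode σ₀ x).val) :
    lehmerWeight σ₀ φ x i ≤ ratioBound φ (n - 2) * lehmerWeight σ₀ φ x (i + 1) := by
  have hc := (lehmerCode σ₀ x).is_lt
  rw [lehmerWeight_eq_precedeWeight σ₀ φ x (i := i) (by omega),
    lehmerWeight_eq_precedeWeight σ₀ φ x (i := i + 1) (by omega),
    show x.val - i = x.val - (i + 1) + 1 by omega]
  refine precedeWeight_succ_le_mul hφ hφ1 hn (notMem_image_Iio σ₀ x) ?_
  have := card_filter_lt_add_lehmerCode σ₀ x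
  omega

end Unimodal

/-! ### Sequences decaying geometrically away from their mode -/

section Mode

variable {p : ℕ → ℝ} {q : ℝ} {c : ℕ} (hp : ∀ i, 0 ≤ p i)
  (hup : ∀ i, c ≤ i → p (i + 1) ≤ q * p i) (hdown : ∀ i, i < c → p i ≤ q * p (i + 1))

include hp hup hdown in
theorem le_mul_mode (hq1 : q < 1) {i : ℕ} (hi : i ≠ c) : p i ≤ q * p c := by
  rcases lt_or_gt_of_ne hi with h | h
  · obtain ⟨k, rfl⟩ := Nat.exists_eq_add_of_lt h
    induction k generalizing i with
    | zero => exact hdown i (by omega)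
    | succ k ih =>
      have h1 := hdown i (by omega)
      have h2 := ih (i := i + 1) (by rwa [show i + 1 + k + 1 = i + (k + 1) + 1 by omega])
        (by rwa [show i + 1 + k + 1 = i + (k + 1) + 1 by omega]) (by omega) (by omega)
      rw [show i + 1 + k + 1 = i + (k + 1) + 1 by omega] at h2
      have h3 := mul_le_mul_of_nonneg_right hq1.le (hp (i + 1))
      linarith
  · obtain ⟨k, rfl⟩ := Nat.exists_eq_add_of_lt h
    induction k with
    | zero => exact hup c le_rfl
    | succ k ih =>
      have h1 := hup (c + k + 1) (by omega)
      have h2 := ih (by omega) (by omega)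
      have h3 := mul_le_mul_of_nonneg_right hq1.le (hp (c + k + 1))
      rw [show c + (k + 1) + 1 = c + k + 1 + 1 by omega]
      linarith

include hp hup hdown in
theorem one_sub_mul_sum_le_mode (hq0 : 0 ≤ q) {X : ℕ} (hc : c ≤ X) :
    (1 - q) * ∑ i ∈ Finset.range (X + 1), p i ≤ (1 + q) * p c := by
  -- Both partial bounds carry a q p term so that the induction telescopes, without summing a
  -- geometric series.
  have hleft : ∀ d, d ≤ c → (1 - q) * ∑ i ∈ Finset.range d, p i ≤ q * p d := by
    intro d
    induction d with
    | zero => intro _; simpa using mul_nonneg hq0 (hp 0)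
    | succ d ih =>
      intro hd
      have h1 := ih (by omega)
      have h2 := hdown d (by omega)
      rw [Finset.sum_range_succ, mul_add]
      linarith
  have hright : ∀ d, (1 - q) * ∑ i ∈ Finset.range (c + 1 + d), p i ≤
      (1 + q) * p c - q * p (c + d) := by
    intro d
    induction d with
    | zero =>
      have h1 := hleft c le_rfl
      rw [add_zero, add_zero, Finset.sum_range_succ, mul_add]
      linarith
    | succ d ih =>
      have h2 := hup (c + d) (by omega)
      rw [← add_assoc, Finset.sum_range_succ, mul_add, show c + 1 + d = c + d + 1 by omega,
        show c + (d + 1) = c + d + 1 by omega]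
      rw [show c + 1 + d = c + d + 1 by omega] at ih
      linarith
  have h := hright (X - c)
  rw [show c + 1 + (X - c) = X + 1 by omega] at h
  have h1 := mul_nonneg hq0 (hp (c + (X - c)))
  linarith

end Mode

/-! ### The constants -/

theorem powSum_eq (φ : ℝ) (s t : ℕ) : powSum φ s t = φ ^ s * geomSum φ (t + 1 - s) := by
  have : Finset.Icc s t = Finset.Ico s (t + 1) := by ext; simp
  rw [powSum, this, Finset.sum_Ico_eq_sum_range, geomSum, Finset.mul_sum]
  exact Finset.sum_congr rfl fun i _ => pow_add φ s i

theorem qConst_eq_ratioBound (φ : ℝ) {n : ℕ} (hn : 2 ≤ n) :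
    qConst φ n = ratioBound φ (n - 2) := by
  rw [qConst, ratioBound, powSum_eq, powSum_eq, pow_one]
  congr 3
  omega

/-- Multiplied by 1 - φ, denominator minus numerator becomes (1 - φ)(1 + φ^(k+2) - φ - φ²). -/
theorem ratioBound_lt_one {φ : ℝ} (hφ : 0 < φ) (hφ1 : φ < 1) {k : ℕ}
    (h : φ + φ ^ 2 < 1 + φ ^ (k + 2)) : ratioBound φ k < 1 := by
  rw [ratioBound, div_lt_one (ratioBound_den_pos hφ k)]
  have h0 : 0 < 1 - φ := by linarith
  refine lt_of_mul_lt_mul_left ?_ h0.le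
  have h1 := one_sub_mul_geomSum φ k
  have h2 := one_sub_mul_geomSum φ (k + 1)
  have h3 : 0 < (1 - φ) * (1 + φ ^ (k + 2) - φ - φ ^ 2) := mul_pos h0 (by linarith)
  calc (1 - φ) * (φ * geomSum φ (k + 1)) = φ * ((1 - φ) * geomSum φ (k + 1)) := by ring
    _ = φ * (1 - φ ^ (k + 1)) := by rw [h2]
    _ < (1 - φ) + φ ^ 3 * (1 - φ ^ k) := by
      have h4 : (1 - φ) + φ ^ 3 * (1 - φ ^ k) - φ * (1 - φ ^ (k + 1)) =
        (1 - φ) * (1 + φ ^ (k + 2) - φ - φ ^ 2) := by ring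
      linarith
    _ = (1 - φ) + φ ^ 3 * ((1 - φ) * geomSum φ k) := by rw [h1]
    _ = (1 - φ) * (1 + φ ^ 3 * geomSum φ k) := by ring

/-- The gap between the probabilities of the most likely value of the Lehmer code at `x` and of
any other value. -/
theorem gap_le_lehmerWeight_sub {n : ℕ} (σ₀ : Ranking n) {φ : ℝ} (hφ0 : 0 < φ) (hφ1 : φ < 1)
    (hn : 2 ≤ n) (hφ : φ + φ ^ 2 < 1 + φ ^ n) (x : Fin n) {i : ℕ}
    (hi : i ≠ (lehmerCode σ₀ x).val) :
    (1 - qConst φ n) ^ 2 / (1 + qConst φ n) ≤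
      lehmerWeight σ₀ φ x (lehmerCode σ₀ x).val / mallowsZ σ₀ φ -
        lehmerWeight σ₀ φ x i / mallowsZ σ₀ φ := by
  have hn2 : n - 2 + 2 = n := by omega
  have hM : φ ^ 2 * geomSum φ (n - 2) ≤ 1 := sq_mul_geomSum_le_one hφ1 (by rw [hn2]; exact hφ.le)
  have hq1 : ratioBound φ (n - 2) < 1 := ratioBound_lt_one hφ0 hφ1 (by rwa [hn2])
  have hq0 := ratioBound_pos hφ0 (n - 2)
  rw [qConst_eq_ratioBound φ hn]
  have hZ := mallowsZ_pos σ₀ hφ0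
  have hnn := lehmerWeight_nonneg σ₀ hφ0 x
  have hup := fun i => lehmerWeight_succ_le σ₀ hφ0 hφ1 hM x (i := i)
  have hdown := fun i => lehmerWeight_le_succ σ₀ hφ0 hφ1 hM x (i := i)
  have h1 := le_mul_mode hnn hup hdown hq1 hi
  have h2 := one_sub_mul_sum_le_mode hnn hup hdown hq0.le
    (Nat.lt_succ_iff.1 (lehmerCode σ₀ x).is_lt)
  rw [sum_lehmerWeight] at h2
  set q := ratioBound φ (n - 2)
  rw [← sub_div, div_le_div_iff₀ (by linarith) hZ]
  have h3 := mul_le_mul_of_nonneg_left h2 (sub_nonneg.2 hq1.le)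
  have h4 := mul_le_mul_of_nonneg_right h1 (by linarith : 0 ≤ 1 + q)
  linarith

/-! ### Concentration -/

instance rankingDiscreteMeasurableSpace (n : ℕ) : DiscreteMeasurableSpace (Equiv.Perm (Fin n)) :=
  ⟨fun _ => MeasurableSpace.measurableSet_top⟩

theorem integral_mallows {n : ℕ} (σ₀ : Ranking n) (φ : ℝ) (hφ : 0 < φ) (g : Ranking n → ℝ) :
    ∫ τ, g τ ∂(mallows σ₀ φ hφ).toMeasure =
      ∑ τ, φ ^ kendallTau σ₀ τ / mallowsZ σ₀ φ * g τ := by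
  rw [PMF.integral_eq_sum]
  refine Finset.sum_congr rfl fun τ _ => ?_
  rw [mallows, PMF.ofFintype_apply, ENNReal.toReal_ofReal, smul_eq_mul]
  exact div_nonneg (pow_nonneg hφ.le _) (mallowsZ_pos σ₀ hφ).le

theorem integral_mallows_lehmerCode {n : ℕ} (σ₀ : Ranking n) (φ : ℝ) (hφ : 0 < φ) (x : Fin n)
    (i c : Fin (x.val + 1)) :
    ∫ τ, ((if lehmerCode τ x = i then 1 else 0) - if lehmerCode τ x = c then 1 else 0 : ℝ)
      ∂(mallows σ₀ φ hφ).toMeasure =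
    lehmerWeight σ₀ φ x i / mallowsZ σ₀ φ - lehmerWeight σ₀ φ x c / mallowsZ σ₀ φ := by
  rw [integral_mallows, lehmerWeight, lehmerWeight, Finset.sum_div, Finset.sum_div,
    ← Finset.sum_sub_distrib]
  refine Finset.sum_congr rfl fun τ _ => ?_
  simp only [Fin.ext_iff]
  split_ifs <;> simp

open MeasureTheory ProbabilityTheory in
/-- Hoeffding's inequality for functions with values in `[-1, 1]` and negative mean. -/
theorem measureReal_zero_le_sum_le {Ω E : Type*} [MeasurableSpace Ω] [MeasurableSpace E]
    {P : Measure Ω} [IsProbabilityMeasure P] {m : ℕ} {σ : Fin m → Ω → E} (hindep : iIndepFun σ P)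
    {ν : Measure E} (hlaw : ∀ k, HasLaw (σ k) ν P) {g : E → ℝ} (hg : Measurable g)
    (hg1 : ∀ e, g e ∈ Set.Icc (-1) 1) {D : ℝ} (hD : 0 ≤ D) (hmean : ∫ e, g e ∂ν ≤ -D) :
    P.real {ω | 0 ≤ ∑ k, g (σ k ω)} ≤ Real.exp (-(m * D ^ 2 / 2)) := by
  have hint : ∀ k, ∫ ω, g (σ k ω) ∂P = ∫ e, g e ∂ν := fun k =>
    (hlaw k).integral_comp hg.aestronglyMeasurable
  -- The parameter 1 is the squared half-length of [-1, 1].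
  have hsub : ∀ k ∈ (Finset.univ : Finset (Fin m)),
      HasSubgaussianMGF (fun ω => g (σ k ω) - ∫ e, g e ∂ν) 1 P := by
    intro k _
    have h := hasSubgaussianMGF_of_mem_Icc (μ := P) (X := fun ω => g (σ k ω)) (a := -1) (b := 1)
      (hg.comp_aemeasurable (hlaw k).aemeasurable) (Filter.Eventually.of_forall fun ω => hg1 _)
    rw [hint k] at h
    convert h using 1
    ext
    norm_num
  have hind : iIndepFun (fun k ω => g (σ k ω) - ∫ e, g e ∂ν) P :=
    hindep.comp (fun _ e => g e - ∫ e, g e ∂ν) fun _ => hg.sub_const _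
  have h := HasSubgaussianMGF.measure_sum_ge_le_of_iIndepFun hind hsub
    (ε := m * D) (by positivity)
  refine (measureReal_mono ?_).trans (h.trans (Real.exp_le_exp.2 ?_))
  · intro ω hω
    simp only [Set.mem_ofPred_eq, Finset.sum_sub_distrib, Finset.sum_const, Finset.card_univ,
      Fintype.card_fin, nsmul_eq_mul] at hω ⊢
    have := mul_le_mul_of_nonneg_left hmean (Nat.cast_nonneg (α := ℝ) m)
    linarith
  · obtain rfl | hm := Nat.eq_zero_or_pos m
    · simp
    · have hm' : (0 : ℝ) < m := by exact_mod_cast hm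
      simp only [Finset.sum_const, Finset.card_univ, Fintype.card_fin, nsmul_eq_mul, mul_one,
        NNReal.coe_natCast]
      apply le_of_eq
      field_simp

/-! ### The aggregator -/

theorem lehmerDecode_lehmerCode {n : ℕ} (σ : Ranking n) : lehmerDecode (lehmerCode σ) = σ :=
  (Equiv.ofBijective lehmerCode (lehmerCode_bijective n)).symm_apply_apply σ

theorem modeOutputs_eq_singleton {n m : ℕ} {S : Fin m → Ranking n} {σ₀ : Ranking n}
    (h : ∀ x, ∀ i ≠ lehmerCode σ₀ x,
      (Finset.univ.filter fun k => lehmerCode (S k) x = i).card <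
        (Finset.univ.filter fun k => lehmerCode (S k) x = lehmerCode σ₀ x).card) :
    modeOutputs S = {σ₀} := by
  ext τ
  simp only [modeOutputs, Set.mem_ofPred_eq, Set.mem_singleton_iff]
  constructor
  · rintro ⟨c, hc, rfl⟩
    have : c = lehmerCode σ₀ := by
      funext x
      by_contra hne
      exact (h x (c x) hne).not_ge (hc x (lehmerCode σ₀ x))
    rw [this, lehmerDecode_lehmerCode]
  · rintro rfl
    refine ⟨lehmerCode τ, fun x w => ?_, (lehmerDecode_lehmerCode τ).symm⟩
    by_cases hw : w = lehmerCode τ x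
    · rw [hw]
    · exact (h x w hw).le

open MeasureTheory ProbabilityTheory in
-- Hoeffding is applied to the indicator of the wrong value i minus that of the true value, whose
-- mean is at most -D with D = (1 - q)²/(1 + q).
theorem measureReal_card_le_card_le {Ω : Type*} [MeasurableSpace Ω] {P : Measure Ω}
    [IsProbabilityMeasure P] {n m : ℕ} {σ₀ : Ranking n} {φ δ : ℝ} (hφ0 : 0 < φ) (hφ1 : φ ≤ 1)
    (hδ : 0 < δ) {σ : Fin m → Ω → Ranking n} (hindep : iIndepFun σ P)
    (hlaw : ∀ k, HasLaw (σ k) (mallows σ₀ φ hφ0).toMeasure P) (hφ : φ + φ ^ 2 < 1 + φ ^ n)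
    (hm : cConst φ n * Real.log ((n : ℝ) ^ 2 / (2 * δ)) ≤ (m : ℝ)) (x : Fin n)
    {i : Fin (x.val + 1)} (hi : i ≠ lehmerCode σ₀ x) :
    P.real {ω | (Finset.univ.filter fun k => lehmerCode (σ k ω) x = lehmerCode σ₀ x).card ≤
      (Finset.univ.filter fun k => lehmerCode (σ k ω) x = i).card} ≤ 2 * δ / (n : ℝ) ^ 2 := by
  -- Coordinate 0 has a single value, so a wrong value forces x ≥ 1.
  have hn : 2 ≤ n := by
    have h1 := i.is_lt
    have h2 := (lehmerCode σ₀ x).is_lt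
    have h3 : i.val ≠ (lehmerCode σ₀ x).val := fun h => hi (Fin.ext h)
    have h4 := x.is_lt
    omega
  have hφ1' : φ < 1 := lt_of_le_of_ne hφ1 fun h => by rw [h] at hφ; norm_num at hφ
  have hgap := gap_le_lehmerWeight_sub σ₀ hφ0 hφ1' hn hφ x (i := i.val)
    fun h => hi (Fin.ext h)
  have hq : qConst φ n < 1 ∧ 0 < qConst φ n := by
    rw [qConst_eq_ratioBound φ hn]
    exact ⟨ratioBound_lt_one hφ0 hφ1' (by rwa [Nat.sub_add_cancel hn]), ratioBound_pos hφ0 _⟩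
  obtain ⟨hq1, hq0⟩ := hq
  rw [cConst] at hm
  set q := qConst φ n
  have hD : 0 < (1 - q) ^ 2 / (1 + q) := by
    have : 0 < 1 - q := by linarith
    positivity
  have hmean := integral_mallows_lehmerCode σ₀ φ hφ0 x i (lehmerCode σ₀ x)
  have hoeff := measureReal_zero_le_sum_le hindep hlaw (g := fun τ =>
    ((if lehmerCode τ x = i then 1 else 0) - if lehmerCode τ x = lehmerCode σ₀ x then 1 else 0))
    Measurable.of_discrete (fun τ => by split_ifs <;> norm_num) hD.le (by rw [hmean]; linarith)
  refine le_trans (le_of_eq ?_) (hoeff.trans ?_)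
  · congr 1
    ext ω
    simp only [Set.mem_ofPred_eq, Finset.sum_sub_distrib, Finset.sum_boole, sub_nonneg,
      Nat.cast_le]
  · have hn0 : (0 : ℝ) < n := by exact_mod_cast (by omega : 0 < n)
    have hlog : Real.log ((n : ℝ) ^ 2 / (2 * δ)) ≤ m * ((1 - q) ^ 2 / (1 + q)) ^ 2 / 2 := by
      have h1 : 0 < 1 - q := by linarith
      have h2 : 0 < 1 + q := by linarith
      rw [div_mul_eq_mul_div, div_le_iff₀ (by positivity)] at hm
      rw [div_pow, ← pow_mul, mul_div_assoc', div_div, le_div_iff₀ (by positivity)]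
      linarith
    calc Real.exp (-(m * ((1 - q) ^ 2 / (1 + q)) ^ 2 / 2))
        ≤ Real.exp (-Real.log ((n : ℝ) ^ 2 / (2 * δ))) := Real.exp_le_exp.2 (by linarith)
      _ = 2 * δ / (n : ℝ) ^ 2 := by
        rw [Real.exp_neg, Real.exp_log (by positivity), inv_div]

end LehmerAggregation

open MeasureTheory LehmerAggregation in
/-- If `σ 0, …, σ (m-1)` are i.i.d. with law `MM(σ₀, φ)`, then with probability at least `1 - δ`
the aggregator outputs `σ₀`, however ties between modes are broken. -/
theorem theorem4p1 {Ω : Type*} [MeasurableSpace Ω] (P : MeasureTheory.Measure Ω)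
    [MeasureTheory.IsProbabilityMeasure P] (n m : ℕ) (σ₀ : LehmerAggregation.Ranking n)
    (φ δ : ℝ) (hφ0 : 0 < φ) (hφ1 : φ ≤ 1) (hδ : 0 < δ)
    (σ : Fin m → Ω → LehmerAggregation.Ranking n)
    (hindep : ProbabilityTheory.iIndepFun σ P)
    (hlaw : ∀ k, ProbabilityTheory.HasLaw (σ k)
      (LehmerAggregation.mallows σ₀ φ hφ0).toMeasure P)
    (hφ : φ + φ ^ 2 < 1 + φ ^ n)
    (hm : LehmerAggregation.cConst φ n * Real.log ((n : ℝ) ^ 2 / (2 * δ)) ≤ (m : ℝ)) :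
    1 - δ ≤ P.real {ω | LehmerAggregation.modeOutputs (fun k => σ k ω) = {σ₀}} := by
  set G := {ω | modeOutputs (fun k => σ k ω) = {σ₀}}
  let bad : (x : Fin n) → Fin (x.val + 1) → Set Ω := fun x i =>
    {ω | (Finset.univ.filter fun k => lehmerCode (σ k ω) x = lehmerCode σ₀ x).card ≤
      (Finset.univ.filter fun k => lehmerCode (σ k ω) x = i).card}
  have hsub : Gᶜ ⊆ ⋃ x ∈ (Finset.univ : Finset (Fin n)),
      ⋃ i ∈ Finset.univ.erase (lehmerCode σ₀ x), bad x i := by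
    intro ω hω
    by_contra hcon
    refine hω (modeOutputs_eq_singleton fun x i hi => ?_)
    by_contra hlt
    refine hcon (Set.mem_biUnion (Finset.mem_univ x) (Set.mem_biUnion (x := i) ?_ ?_))
    · simpa using hi
    · exact not_lt.1 hlt
  have hGc : P.real Gᶜ ≤ δ := by
    calc P.real Gᶜ ≤ ∑ x : Fin n, ∑ i ∈ Finset.univ.erase (lehmerCode σ₀ x), P.real (bad x i) :=
          (measureReal_mono hsub (measure_ne_top _ _)).trans ((measureReal_biUnion_finset_le _ _).trans
            (Finset.sum_le_sum fun x _ => measureReal_biUnion_finset_le _ _))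
      _ ≤ ∑ x : Fin n, ∑ i ∈ Finset.univ.erase (lehmerCode σ₀ x), 2 * δ / (n : ℝ) ^ 2 :=
          Finset.sum_le_sum fun x _ => Finset.sum_le_sum fun i hi =>
            measureReal_card_le_card_le hφ0 hφ1 hδ hindep hlaw hφ hm x (Finset.ne_of_mem_erase hi)
      -- Coordinate x, counted from 0, has exactly x wrong values.
      _ = (∑ x ∈ Finset.range n, (x : ℝ)) * (2 * δ / (n : ℝ) ^ 2) := by
          rw [← Fin.sum_univ_eq_sum_range (fun k => (k : ℝ)), Finset.sum_mul]
          refine Finset.sum_congr rfl fun x _ => ?_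
          rw [Finset.sum_const, Finset.card_erase_of_mem (Finset.mem_univ _), Finset.card_univ,
            Fintype.card_fin, Nat.add_sub_cancel, nsmul_eq_mul]
      _ ≤ δ := by
          obtain rfl | hn := Nat.eq_zero_or_pos n
          · simpa using hδ.le
          have hn' : (0 : ℝ) < n := by exact_mod_cast hn
          have hsum : (∑ x ∈ Finset.range n, (x : ℝ)) * 2 ≤ (n : ℝ) ^ 2 := by
            have h : (∑ x ∈ Finset.range n, x) * 2 ≤ n ^ 2 := by
              rw [Finset.sum_range_id_mul_two, sq]
              exact Nat.mul_le_mul_left n (Nat.sub_le n 1)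
            have h' := (Nat.cast_le (α := ℝ)).2 h
            push_cast at h'
            exact h'
          rw [mul_div_assoc', div_le_iff₀ (by positivity)]
          have := mul_le_mul_of_nonneg_left hsum hδ.le
          linarith
  -- Subadditivity suffices and avoids measurability of G.
  have huniv : P.real Set.univ ≤ P.real G + P.real Gᶜ := by
    rw [← Set.union_compl_self G]
    exact measureReal_union_le _ _
  rw [probReal_univ] at huniv
  linarith
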